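/- **Conventions.** All spaces are real. A Banach lattice $X$ is *LASQ+* if for every $y\in X$ with $\|y\|=1$ and every $\varepsilon>0$ there is $x\in X$ with $x\ge 0$, $\|x\|=1$ and $\|y\pm x\|\le 1+\varepsilon$. A Banach space $X$ has the *diameter two property* if every non-empty relatively weakly open subset of its closed unit ball $B_X$ has diameter $2$. Let $(S,\mathcal A,\mu)$ be a complete, $\sigma$-finite measure space. A *Köthe function space* over $S$ is a Banach space $(E,\|\cdot\|_E)$ of (classes modulo $\mu$-a.e. equality of) real-valued measurable functions on $S$ such that 1. $\chi_A\in E$ for every $A\in\mathcal A$ with $\mu(A)<\infty$; 2. every $f\in E$ is $\mu$-integrable over every $A\in\mathcal A$ with $\mu(A)<\infty$; 3. if $g$ is measurable, $f\in E$ and $|g|\le|f|$ $\mu$-a.e., then $g\in E$ and $\|g\|_E\le\|f\|_E$. For a Banach lattice $X$, the *Köthe–Bochner space* $E(X)$ is the space of all (classes of) strongly ($\mu$-)measurable functions $f:S\to X$ with $\|f(\cdot)\|\in E$, normed by $\|f\|_{E(X)}=\big\|\,\|f(\cdot)\|\,\big\|_E$ and ordered pointwise a.e.; it is a Banach lattice.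 **Statement.** Let $(S,\mathcal A,\mu)$ be a complete, $\sigma$-finite measure space with $\mu\neq 0$, let $E$ be a Köthe function space over $S$ and let $X\neq\{0\}$ be a Banach lattice. If $X$ is LASQ+, then $E(X)$ is LASQ+, and $E(X)$ has the diameter two property. -/

import Mathlib

open MeasureTheory Filter Topology

noncomputable section

/-- A normed lattice `X` (in the application: a real Banach lattice) is LASQ+ if for every `y` in
the unit sphere and every `ε > 0` there is a positive `x` in the unit sphere such that
`‖y + x‖ ≤ 1 + ε` and `‖y - x‖ ≤ 1 + ε`. -/
def IsLASQPlus (X : Type*) [NormedAddCommGroup X] [Lattice X] : Prop :=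
  ∀ y : X, ‖y‖ = 1 → ∀ ε : ℝ, 0 < ε →
    ∃ x : X, 0 ≤ x ∧ ‖x‖ = 1 ∧ ‖y + x‖ ≤ 1 + ε ∧ ‖y - x‖ ≤ 1 + ε

/-- A real normed space has the diameter two property if every non-empty relatively weakly open
subset of its closed unit ball has diameter `2`. -/
def HasDiameterTwoProperty (X : Type*) [NormedAddCommGroup X] [NormedSpace ℝ X] : Prop :=
  ∀ V : Set (WeakSpace ℝ X), IsOpen V →
    ((toWeakSpace ℝ X ⁻¹' V) ∩ Metric.closedBall (0 : X) 1).Nonempty →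
      Metric.diam ((toWeakSpace ℝ X ⁻¹' V) ∩ Metric.closedBall (0 : X) 1) = 2

/-- A Köthe function space over a measure space `(S, μ)`: a linear space `carrier` of (classes
modulo a.e. equality of) real measurable functions, with a complete norm, such that
* indicators of measurable sets of finite measure belong to the space,
* its elements are integrable over measurable sets of finite measure,
* it is an ideal, and its norm is monotone: if `g` is measurable, `f` is in the space and
  `|g| ≤ |f|` a.e., then `g` is in the space and its norm is at most that of `f`.

The norm is recorded as a seminorm that vanishes only at `0`; completeness says that every
Cauchy sequence converges. -/
structure KotheFunctionSpace {S : Type*} [MeasurableSpace S] (μ : Measure S) where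
  carrier : Submodule ℝ (S →ₘ[μ] ℝ)
  normE : Seminorm ℝ carrier
  eq_zero_of_normE : ∀ f : carrier, normE f = 0 → f = 0
  complete : ∀ u : ℕ → carrier,
    (∀ ε : ℝ, 0 < ε → ∃ N : ℕ, ∀ m ≥ N, ∀ n ≥ N, normE (u m - u n) < ε) →
      ∃ f : carrier, Tendsto (fun n => normE (u n - f)) atTop (𝓝 0)
  indicator_mem : ∀ (A : Set S) (hA : MeasurableSet A), μ A < ⊤ →
    AEEqFun.mk (A.indicator fun _ => (1 : ℝ))
      (aestronglyMeasurable_const.indicator hA) ∈ carrier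
  integrableOn : ∀ f ∈ carrier, ∀ A : Set S, MeasurableSet A → μ A < ⊤ →
    IntegrableOn (fun s => f s) A μ
  mem_of_le : ∀ (f g : S →ₘ[μ] ℝ), f ∈ carrier → (∀ᵐ s ∂μ, |g s| ≤ |f s|) → g ∈ carrier
  normE_le : ∀ f g : carrier,
    (∀ᵐ s ∂μ, |(g : S →ₘ[μ] ℝ) s| ≤ |(f : S →ₘ[μ] ℝ) s|) → normE g ≤ normE f

section KotheBochner

variable {S : Type*} [MeasurableSpace S] {μ : Measure S}

/-- The class of the scalar function `s ↦ ‖f s‖`. -/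
def normFn {X : Type*} [NormedAddCommGroup X] (f : S →ₘ[μ] X) : S →ₘ[μ] ℝ :=
  AEEqFun.comp (fun x : X => ‖x‖) continuous_norm f

theorem coeFn_normFn {X : Type*} [NormedAddCommGroup X] (f : S →ₘ[μ] X) :
    ∀ᵐ s ∂μ, normFn f s = ‖f s‖ :=
  AEEqFun.coeFn_comp _ _ f

/-- If `‖f s‖ ≤ |g s|` a.e. and `g` belongs to `E`, so does `s ↦ ‖f s‖`. -/
theorem KotheFunctionSpace.normFn_mem_of_le (E : KotheFunctionSpace μ)
    {X : Type*} [NormedAddCommGroup X] {f : S →ₘ[μ] X} {g : S →ₘ[μ] ℝ} (hg : g ∈ E.carrier)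
    (h : ∀ᵐ s ∂μ, ‖f s‖ ≤ |g s|) : normFn f ∈ E.carrier := by
  refine E.mem_of_le g _ hg ?_
  filter_upwards [h, coeFn_normFn f] with s h1 h2
  rw [h2, abs_norm]
  exact h1

/-- The underlying vector space of the Köthe–Bochner space: all (classes of) strongly measurable
`f : S → X` such that `s ↦ ‖f s‖` belongs to `E`. -/
def KotheFunctionSpace.bochnerSubmodule (E : KotheFunctionSpace μ)
    (X : Type*) [NormedAddCommGroup X] [NormedSpace ℝ X] : Submodule ℝ (S →ₘ[μ] X) where
  carrier := {f | normFn f ∈ E.carrier}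
  zero_mem' := by
    refine E.normFn_mem_of_le E.carrier.zero_mem ?_
    filter_upwards [AEEqFun.coeFn_zero (μ := μ) (β := X)] with s h1
    simp [h1]
  add_mem' := by
    intro f g hf hg
    refine E.normFn_mem_of_le (E.carrier.add_mem hf hg) ?_
    filter_upwards [AEEqFun.coeFn_add f g, AEEqFun.coeFn_add (normFn f) (normFn g),
      coeFn_normFn f, coeFn_normFn g] with s h1 h2 h3 h4
    rw [h1, h2, Pi.add_apply, Pi.add_apply, h3, h4]
    exact (norm_add_le _ _).trans (le_abs_self _)
  smul_mem' := by
    intro c f hf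
    refine E.normFn_mem_of_le (E.carrier.smul_mem c hf) ?_
    filter_upwards [AEEqFun.coeFn_smul c f, AEEqFun.coeFn_smul c (normFn f),
      coeFn_normFn f] with s h1 h2 h3
    rw [h1, h2, Pi.smul_apply, Pi.smul_apply, h3, norm_smul, smul_eq_mul, abs_mul, abs_norm,
      Real.norm_eq_abs]

/-- The Köthe–Bochner space `E(X)`. -/
def KotheBochner (E : KotheFunctionSpace μ)
    (X : Type*) [NormedAddCommGroup X] [NormedSpace ℝ X] : Type _ :=
  E.bochnerSubmodule X

namespace KotheBochner

variable {E : KotheFunctionSpace μ} {X : Type*} [NormedAddCommGroup X] [NormedSpace ℝ X]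

instance : AddCommGroup (KotheBochner E X) :=
  inferInstanceAs (AddCommGroup (E.bochnerSubmodule X))

instance : Module ℝ (KotheBochner E X) :=
  inferInstanceAs (Module ℝ (E.bochnerSubmodule X))

/-- The element `s ↦ ‖f s‖` of `E`. -/
def toE (f : KotheBochner E X) : E.carrier := ⟨normFn f.1, f.2⟩

theorem toE_ae (f : KotheBochner E X) : ∀ᵐ s ∂μ, (toE f).1 s = ‖f.1 s‖ := coeFn_normFn f.1

theorem coe_add_ae (f g : KotheBochner E X) : ∀ᵐ s ∂μ, (f + g).1 s = f.1 s + g.1 s :=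
  AEEqFun.coeFn_add f.1 g.1

theorem coe_sub_ae (f g : KotheBochner E X) : ∀ᵐ s ∂μ, (f - g).1 s = f.1 s - g.1 s :=
  AEEqFun.coeFn_sub f.1 g.1

theorem coe_neg_ae (f : KotheBochner E X) : ∀ᵐ s ∂μ, (-f).1 s = -f.1 s :=
  AEEqFun.coeFn_neg f.1

theorem coe_smul_ae (c : ℝ) (f : KotheBochner E X) : ∀ᵐ s ∂μ, (c • f).1 s = c • f.1 s :=
  AEEqFun.coeFn_smul c f.1

theorem coe_zero_ae : ∀ᵐ s ∂μ, (0 : KotheBochner E X).1 s = 0 :=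
  AEEqFun.coeFn_zero (μ := μ) (β := X)

theorem normE_toE_le (f : KotheBochner E X) (g : E.carrier)
    (h : ∀ᵐ s ∂μ, ‖f.1 s‖ ≤ |g.1 s|) : E.normE (toE f) ≤ E.normE g := by
  refine E.normE_le _ _ ?_
  filter_upwards [h, toE_ae f] with s h1 h2
  rw [h2, abs_norm]
  exact h1

/-- The norm `‖f‖ = ‖ s ↦ ‖f s‖ ‖_E` of `E(X)`. -/
def addGroupNorm (E : KotheFunctionSpace μ) (X : Type*) [NormedAddCommGroup X]
    [NormedSpace ℝ X] : AddGroupNorm (KotheBochner E X) where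
  toFun f := E.normE (toE f)
  map_zero' := by
    refine le_antisymm ?_ (apply_nonneg _ _)
    rw [← map_zero E.normE]
    refine normE_toE_le _ _ ?_
    filter_upwards [coe_zero_ae (E := E) (X := X)] with s h1
    simp [h1]
  add_le' f g := by
    refine le_trans (normE_toE_le _ (toE f + toE g) ?_) (map_add_le_add _ _ _)
    filter_upwards [coe_add_ae f g, AEEqFun.coeFn_add (toE f).1 (toE g).1,
      toE_ae f, toE_ae g] with s h1 h2 h3 h4
    rw [h1, Submodule.coe_add, h2, Pi.add_apply, h3, h4]
    exact (norm_add_le _ _).trans (le_abs_self _)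
  neg' f := by
    refine le_antisymm (normE_toE_le _ _ ?_) (normE_toE_le _ _ ?_)
    · filter_upwards [coe_neg_ae f, toE_ae f] with s h1 h2
      rw [h1, h2, norm_neg, abs_norm]
    · filter_upwards [coe_neg_ae f, toE_ae (-f)] with s h1 h2
      rw [h2, h1, norm_neg, abs_norm]
  eq_zero_of_map_eq_zero' f hf := by
    have h0 : (toE f).1 = 0 := by rw [E.eq_zero_of_normE _ hf]; rfl
    refine Subtype.ext (AEEqFun.ext ?_)
    filter_upwards [toE_ae f, coe_zero_ae (E := E) (X := X),
      AEEqFun.coeFn_zero (μ := μ) (β := ℝ)] with s h1 h2 h3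
    rw [h0, h3, Pi.zero_apply] at h1
    rw [h2]
    exact norm_eq_zero.1 h1.symm

instance : NormedAddCommGroup (KotheBochner E X) :=
  (addGroupNorm E X).toNormedAddCommGroup

theorem norm_def (f : KotheBochner E X) : ‖f‖ = E.normE (toE f) := rfl

theorem norm_le_of_ae (f g : KotheBochner E X) (h : ∀ᵐ s ∂μ, ‖f.1 s‖ ≤ ‖g.1 s‖) :
    ‖f‖ ≤ ‖g‖ := by
  refine normE_toE_le _ _ ?_
  filter_upwards [h, toE_ae g] with s h1 h2
  rw [h2, abs_norm]
  exact h1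

instance : NormedSpace ℝ (KotheBochner E X) where
  norm_smul_le c f := by
    rw [norm_def, norm_def, ← map_smul_eq_mul]
    refine normE_toE_le _ _ ?_
    filter_upwards [coe_smul_ae c f, AEEqFun.coeFn_smul c (toE f).1, toE_ae f] with s h1 h2 h3
    rw [h1, Submodule.coe_smul, h2, Pi.smul_apply, h3, norm_smul, smul_eq_mul, abs_mul,
      abs_norm, Real.norm_eq_abs]

theorem coe_sum_ae (u : ℕ → KotheBochner E X) (n : ℕ) :
    ∀ᵐ s ∂μ, (∑ i ∈ Finset.range n, u i).1 s = ∑ i ∈ Finset.range n, (u i).1 s := by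
  induction n with
  | zero =>
    filter_upwards [coe_zero_ae (E := E) (X := X)] with s h
    simpa using h
  | succ n ih =>
    rw [Finset.sum_range_succ]
    filter_upwards [ih, coe_add_ae (∑ i ∈ Finset.range n, u i) (u n)] with s h1 h2
    rw [h2, h1, Finset.sum_range_succ]

theorem coe_sum_toE_ae (u : ℕ → KotheBochner E X) (n : ℕ) :
    ∀ᵐ s ∂μ, (∑ i ∈ Finset.range n, toE (u i)).1 s = ∑ i ∈ Finset.range n, ‖(u i).1 s‖ := by
  induction n with
  | zero =>
    filter_upwards [AEEqFun.coeFn_zero (μ := μ) (β := ℝ)] with s h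
    simpa using h
  | succ n ih =>
    rw [Finset.sum_range_succ]
    filter_upwards [ih, AEEqFun.coeFn_add (∑ i ∈ Finset.range n, toE (u i)).1 (toE (u n)).1,
      toE_ae (u n)] with s h1 h2 h3
    rw [Submodule.coe_add, h2, Pi.add_apply, h1, h3, Finset.sum_range_succ]

/-- Absolutely summable series in `E` converge. -/
theorem exists_tendsto_sum (E : KotheFunctionSpace μ) (v : ℕ → E.carrier)
    (hv : Summable fun n => E.normE (v n)) : ∃ g : E.carrier,
      Tendsto (fun n => E.normE (∑ i ∈ Finset.range n, v i - g)) atTop (𝓝 0) := by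
  let N : AddGroupNorm E.carrier :=
    { toFun := E.normE, map_zero' := map_zero _, add_le' := map_add_le_add _,
      neg' := map_neg_eq_map _, eq_zero_of_map_eq_zero' := E.eq_zero_of_normE }
  let _ : NormedAddCommGroup E.carrier := N.toNormedAddCommGroup
  have hc : CauchySeq fun n => ∑ i ∈ Finset.range n, v i :=
    cauchySeq_range_of_norm_bounded hv.hasSum.tendsto_sum_nat.cauchySeq
      fun i => le_of_eq rfl
  refine E.complete _ fun ε hε => ?_
  obtain ⟨n₀, h⟩ := Metric.cauchySeq_iff.1 hc ε hε
  refine ⟨n₀, fun m hm n hn => ?_⟩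
  have := h m hm n hn
  rwa [dist_eq_norm] at this

/-- If the series `∑ v i` of nonnegative elements converges to `g` in `E`, its partial sums are
at most `g` almost everywhere. -/
theorem sum_le_of_tendsto (u : ℕ → KotheBochner E X) (g : E.carrier)
    (hg : Tendsto (fun n => E.normE (∑ i ∈ Finset.range n, toE (u i) - g)) atTop (𝓝 0)) (n : ℕ) :
    ∀ᵐ s ∂μ, ∑ i ∈ Finset.range n, ‖(u i).1 s‖ ≤ g.1 s := by
  set σ : ℕ → E.carrier := fun n => ∑ i ∈ Finset.range n, toE (u i) with hσ
  set d : S →ₘ[μ] ℝ := (σ n - g).1 ⊔ 0 with hd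
  have hdle : ∀ m ≥ n, ∀ᵐ s ∂μ, |d s| ≤ |(σ m - g).1 s| := by
    intro m hm
    filter_upwards [AEEqFun.coeFn_sup (σ n - g).1 0, AEEqFun.coeFn_zero (μ := μ) (β := ℝ),
      AEEqFun.coeFn_sub (σ n).1 g.1, AEEqFun.coeFn_sub (σ m).1 g.1, coe_sum_toE_ae u n,
      coe_sum_toE_ae u m] with s h1 h2 h3 h4 h5 h6
    rw [hd, h1, h2, Submodule.coe_sub, Submodule.coe_sub, h3, h4, Pi.sub_apply, Pi.sub_apply,
      hσ, h5, h6, Pi.zero_apply, abs_of_nonneg le_sup_right]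
    refine sup_le (le_trans ?_ (le_abs_self _)) (abs_nonneg _)
    gcongr
  have hdm : d ∈ E.carrier := E.mem_of_le _ _ (σ n - g).2 (hdle n le_rfl)
  have h0 : E.normE ⟨d, hdm⟩ = 0 := by
    refine le_antisymm (ge_of_tendsto hg ?_) (apply_nonneg _ _)
    filter_upwards [eventually_ge_atTop n] with m hm
    exact E.normE_le _ _ (hdle m hm)
  have hd0 : d = 0 := congrArg Subtype.val (E.eq_zero_of_normE _ h0)
  filter_upwards [AEEqFun.coeFn_sup (σ n - g).1 0, AEEqFun.coeFn_zero (μ := μ) (β := ℝ),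
    AEEqFun.coeFn_sub (σ n).1 g.1, coe_sum_toE_ae u n] with s h1 h2 h3 h5
  rw [← hd, hd0, h2, Submodule.coe_sub, h3, Pi.sub_apply, hσ, h5, Pi.zero_apply] at h1
  have := le_sup_left.trans h1.symm.le
  linarith

instance [CompleteSpace X] : CompleteSpace (KotheBochner E X) := by
  refine NormedAddCommGroup.completeSpace_of_summable_imp_tendsto fun u hu => ?_
  obtain ⟨g, hg⟩ := exists_tendsto_sum E (fun n => toE (u n)) hu
  have hle : ∀ᵐ s ∂μ, ∀ n, ∑ i ∈ Finset.range n, ‖(u i).1 s‖ ≤ g.1 s :=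
    ae_all_iff.2 (sum_le_of_tendsto u g hg)
  have hsum : ∀ᵐ s ∂μ, Summable fun i => ‖(u i).1 s‖ := by
    filter_upwards [hle] with s hs
    exact summable_of_sum_range_le (fun _ => norm_nonneg _) hs
  have htend : ∀ᵐ s ∂μ, Tendsto (fun n => ∑ i ∈ Finset.range n, (u i).1 s) atTop
      (𝓝 (∑' i, (u i).1 s)) := by
    filter_upwards [hsum] with s hs
    exact hs.of_norm.hasSum.tendsto_sum_nat
  have hmeas : AEStronglyMeasurable (fun s => ∑' i, (u i).1 s) μ := by
    refine aestronglyMeasurable_of_tendsto_ae atTop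
      (f := fun n s => ∑ i ∈ Finset.range n, (u i).1 s) (fun n => ?_) htend
    exact Finset.aestronglyMeasurable_fun_sum _ fun i _ => (u i).1.aestronglyMeasurable
  have hbd : ∀ᵐ s ∂μ, ∀ n, ‖∑ i ∈ Finset.range n, (u i).1 s - ∑' i, (u i).1 s‖ ≤
      g.1 s - ∑ i ∈ Finset.range n, ‖(u i).1 s‖ := by
    filter_upwards [hle, htend] with s h1 h2 n
    refine le_of_tendsto ((tendsto_const_nhds.sub h2).norm) ?_
    filter_upwards [eventually_ge_atTop n] with m hm
    rw [norm_sub_rev, ← Finset.sum_Ico_eq_sub _ hm]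
    refine (norm_sum_le _ _).trans ?_
    rw [Finset.sum_Ico_eq_sub _ hm]
    linarith [h1 m]
  have hmem : AEEqFun.mk _ hmeas ∈ E.bochnerSubmodule X := by
    refine E.normFn_mem_of_le g.2 ?_
    filter_upwards [hbd, AEEqFun.coeFn_mk _ hmeas] with s h1 h2
    have := h1 0
    simp only [Finset.range_zero, Finset.sum_empty, zero_sub, norm_neg, sub_zero] at this
    rw [h2]
    exact this.trans (le_abs_self _)
  let f : KotheBochner E X := ⟨AEEqFun.mk _ hmeas, hmem⟩
  refine ⟨f, tendsto_iff_norm_sub_tendsto_zero.2 ?_⟩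
  refine squeeze_zero (fun _ => norm_nonneg _) (fun n => ?_) hg
  refine normE_toE_le _ _ ?_
  filter_upwards [hbd, AEEqFun.coeFn_mk _ hmeas, coe_sub_ae (∑ i ∈ Finset.range n, u i) f,
    coe_sum_ae u n, AEEqFun.coeFn_sub (∑ i ∈ Finset.range n, toE (u i)).1 g.1,
    coe_sum_toE_ae u n] with s h1 h2 h3 h4 h5 h6
  rw [h3, h4, Submodule.coe_sub, h5, Pi.sub_apply, h6, abs_sub_comm]
  refine le_trans ?_ ((h1 n).trans (le_abs_self _))
  rw [← h2]

section Order

variable [Lattice X] [HasSolidNorm X] [IsOrderedAddMonoid X]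

/-- The lattice operations and the order of `E(X)` are the almost everywhere pointwise ones. -/
instance : Lattice (KotheBochner E X) :=
  Subtype.lattice
    (fun f g hf hg => by
      refine E.normFn_mem_of_le (E.carrier.add_mem hf hg) ?_
      filter_upwards [AEEqFun.coeFn_sup f g, AEEqFun.coeFn_add (normFn f) (normFn g),
        coeFn_normFn f, coeFn_normFn g] with s h1 h2 h3 h4
      rw [h1, h2, Pi.add_apply, h3, h4]
      exact (norm_sup_le_add _ _).trans (le_abs_self _))
    (fun f g hf hg => by
      refine E.normFn_mem_of_le (E.carrier.add_mem hf hg) ?_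
      filter_upwards [AEEqFun.coeFn_inf f g, AEEqFun.coeFn_add (normFn f) (normFn g),
        coeFn_normFn f, coeFn_normFn g] with s h1 h2 h3 h4
      rw [h1, h2, Pi.add_apply, h3, h4]
      exact (norm_inf_le_add _ _).trans (le_abs_self _))

theorem le_iff_ae (f g : KotheBochner E X) : f ≤ g ↔ ∀ᵐ s ∂μ, f.1 s ≤ g.1 s :=
  AEEqFun.coeFn_le.symm

theorem coe_abs_ae (f : KotheBochner E X) : ∀ᵐ s ∂μ, (|f|).1 s = |f.1 s| :=
  AEEqFun.coeFn_abs f.1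

instance : IsOrderedAddMonoid (KotheBochner E X) where
  add_le_add_left f g h k := by
    rw [le_iff_ae] at h ⊢
    filter_upwards [h, coe_add_ae f k, coe_add_ae g k] with s h1 h2 h3
    rw [h2, h3]
    gcongr

instance : HasSolidNorm (KotheBochner E X) where
  solid f g h := by
    refine norm_le_of_ae _ _ ?_
    filter_upwards [(le_iff_ae _ _).1 h, coe_abs_ae f, coe_abs_ae g] with s h1 h2 h3
    rw [h2, h3] at h1
    exact norm_le_norm_of_abs_le_abs h1

instance [IsOrderedModule ℝ X] : IsOrderedModule ℝ (KotheBochner E X) where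
  smul_le_smul_of_nonneg_left c hc f g h := by
    rw [le_iff_ae] at h ⊢
    filter_upwards [h, coe_smul_ae c f, coe_smul_ae c g] with s h1 h2 h3
    rw [h2, h3]
    exact smul_le_smul_of_nonneg_left h1 hc
  smul_le_smul_of_nonneg_right f hf c d h := by
    rw [le_iff_ae] at hf ⊢
    filter_upwards [hf, coe_smul_ae c f, coe_smul_ae d f, coe_zero_ae (E := E) (X := X)]
      with s h1 h2 h3 h4
    rw [h4] at h1
    rw [h2, h3]
    exact smul_le_smul_of_nonneg_right h h1

end Order

end KotheBochner

end KotheBochner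

end

open MeasureTheory Filter Topology

/-! The proof has two independent halves. LASQ+ passes from `X` to `E(X)` fibrewise: given `f` of
norm one, a strongly measurable `h ≥ 0` is found with `‖h s‖ = ‖f s‖` and `‖f s ± h s‖ ≤ (1 + ε) ‖f
s‖` (`IsLASQPlus.exists_stronglyMeasurable`), and monotonicity of the norm of `E` turns these
pointwise relations into the required ones in `E(X)`. Every nonzero LASQ+ normed lattice has the
diameter two property: iterating LASQ+ gives positive unit vectors `x n` with bounded partial sums
(`IsLASQPlus.exists_seq`). Such a sequence is weakly null, while a positive vector dominating the
sums keeps the points `r⁻¹ • (y ± x n)` in the unit ball. They tend weakly to `r⁻¹ • y` and are `2 /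
r` apart, with `r > 1` arbitrarily close to `1`. -/

theorem norm_le_norm_of_abs_le {Y : Type*} [NormedAddCommGroup Y] [Lattice Y] [HasSolidNorm Y]
    {a b : Y} (hab : |a| ≤ b) : ‖a‖ ≤ ‖b‖ :=
  norm_le_norm_of_abs_le_abs (hab.trans (le_abs_self b))

theorem norm_le_norm_of_nonneg_of_le {Y : Type*} [NormedAddCommGroup Y] [Lattice Y]
    [HasSolidNorm Y] [IsOrderedAddMonoid Y] {a b : Y} (ha : 0 ≤ a) (hab : a ≤ b) : ‖a‖ ≤ ‖b‖ :=
  norm_le_norm_of_abs_le (by rwa [abs_of_nonneg ha])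

theorem tendsto_toWeakSpace {Y : Type*} [NormedAddCommGroup Y] [NormedSpace ℝ Y]
    {ι : Type*} {l : Filter ι} {u : ι → Y} {y : Y}
    (h : ∀ φ : Y →L[ℝ] ℝ, Tendsto (fun i => φ (u i)) l (𝓝 (φ y))) :
    Tendsto (fun i => toWeakSpace ℝ Y (u i)) l (𝓝 (toWeakSpace ℝ Y y)) := by
  refine (WeakBilin.tendsto_iff_forall_eval_tendsto (topDualPairing ℝ Y).flip ?_).2 h
  intro a b hab
  exact (SeparatingDual.eq_iff_forall_dual_eq (R := ℝ)).2 fun φ => DFunLike.congr_fun hab φ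

/-! ### LASQ+ implies the diameter two property. -/

section NormedLattice

variable {Y : Type*} [NormedAddCommGroup Y] [NormedSpace ℝ Y] [Lattice Y]
  [IsOrderedAddMonoid Y] [HasSolidNorm Y]

theorem norm_sum_smul_le_norm_sum [IsOrderedModule ℝ Y] (x : ℕ → Y) (hx : ∀ n, 0 ≤ x n)
    (c : ℕ → ℝ) (hc : ∀ n, |c n| ≤ 1) (s : Finset ℕ) :
    ‖∑ i ∈ s, c i • x i‖ ≤ ‖∑ i ∈ s, x i‖ := by
  refine norm_le_norm_of_abs_le (abs_le'.2 ⟨Finset.sum_le_sum fun i _ => ?_, ?_⟩)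
  · simpa using smul_le_smul_of_nonneg_right (abs_le.1 (hc i)).2 (hx i)
  · rw [← Finset.sum_neg_distrib]
    refine Finset.sum_le_sum fun i _ => ?_
    rw [← neg_smul]
    simpa using smul_le_smul_of_nonneg_right (neg_le.1 (abs_le.1 (hc i)).1) (hx i)

/-- A sequence of positive elements whose partial sums are norm bounded is weakly null. -/
theorem tendsto_apply_zero_of_norm_sum_le [IsOrderedModule ℝ Y] (x : ℕ → Y) (hx : ∀ n, 0 ≤ x n)
    (C : ℝ) (hC : ∀ n, ‖∑ i ∈ Finset.range n, x i‖ ≤ C) (φ : Y →L[ℝ] ℝ) :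
    Tendsto (fun n => φ (x n)) atTop (𝓝 0) := by
  have hs : Summable fun n => |φ (x n)| := by
    refine summable_of_sum_range_le (c := ‖φ‖ * C) (fun _ => abs_nonneg _) fun n => ?_
    -- Absorbing the signs into the vectors makes this one value of `φ`, at a combination whose norm
    -- solidity bounds by that of the unsigned sum.
    have h1 : ∑ i ∈ Finset.range n, |φ (x i)|
        = φ (∑ i ∈ Finset.range n, (SignType.sign (φ (x i)) : ℝ) • x i) := by
      rw [map_sum]
      refine Finset.sum_congr rfl fun i _ => ?_
      rw [map_smul, smul_eq_mul, sign_mul_self]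
    rw [h1]
    refine (le_abs_self _).trans ((φ.le_opNorm _).trans ?_)
    gcongr
    refine (norm_sum_smul_le_norm_sum x hx _ (fun i => ?_) _).trans (hC n)
    rcases SignType.sign (φ (x i)) <;> simp
  exact (tendsto_zero_iff_abs_tendsto_zero _).2 hs.tendsto_atTop_zero

theorem IsLASQPlus.exists_norm_add_lt [IsOrderedModule ℝ Y] (hY : IsLASQPlus Y) {z : Y} {r : ℝ}
    (hz0 : 0 ≤ z) (hz : 1 ≤ ‖z‖) (hr : ‖z‖ < r) : ∃ x : Y, 0 ≤ x ∧ ‖x‖ = 1 ∧ ‖z + x‖ < r := by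
  have h0 : 0 < ‖z‖ := one_pos.trans_le hz
  -- With this `ε`, `‖z‖ * (1 + ε)` is the midpoint of `‖z‖` and `r`.
  have hε : 0 < (r / ‖z‖ - 1) / 2 := by
    have : 1 < r / ‖z‖ := (one_lt_div h0).2 hr
    linarith
  obtain ⟨x, hx, hx1, hp, -⟩ := hY (‖z‖⁻¹ • z)
    (by rw [norm_smul, norm_inv, norm_norm, inv_mul_cancel₀ h0.ne']) _ hε
  refine ⟨x, hx, hx1, ?_⟩
  have hle : z + x ≤ ‖z‖ • (‖z‖⁻¹ • z + x) := by
    rw [smul_add, smul_inv_smul₀ h0.ne']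
    gcongr
    simpa using smul_le_smul_of_nonneg_right hz hx
  calc ‖z + x‖ ≤ ‖‖z‖ • (‖z‖⁻¹ • z + x)‖ := norm_le_norm_of_nonneg_of_le (add_nonneg hz0 hx) hle
    _ ≤ ‖z‖ * (1 + (r / ‖z‖ - 1) / 2) := by
      rw [norm_smul, norm_norm]
      gcongr
    _ = (‖z‖ + r) / 2 := by field_simp; ring
    _ < r := by linarith

/-- In an LASQ+ lattice, a positive unit vector extends to a `c₀`-like positive sequence. -/
theorem IsLASQPlus.exists_seq [IsOrderedModule ℝ Y] (hY : IsLASQPlus Y) {w : Y} (hw : 0 ≤ w)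
    (hw1 : ‖w‖ = 1) {r : ℝ} (hr : 1 < r) :
    ∃ x : ℕ → Y, (∀ n, 0 ≤ x n) ∧ (∀ n, ‖x n‖ = 1) ∧
      ∀ n, ‖w + ∑ i ∈ Finset.range n, x i‖ ≤ r := by
  -- The state is the running sum; its strict bound by `r` leaves room for every further step.
  have step : ∀ z : {z : Y // 0 ≤ z ∧ 1 ≤ ‖z‖ ∧ ‖z‖ < r},
      ∃ x : Y, 0 ≤ x ∧ ‖x‖ = 1 ∧ ‖z.1 + x‖ < r :=
    fun z => hY.exists_norm_add_lt z.2.1 z.2.2.1 z.2.2.2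
  choose F hF0 hF1 hFr using step
  let next : {z : Y // 0 ≤ z ∧ 1 ≤ ‖z‖ ∧ ‖z‖ < r} → {z : Y // 0 ≤ z ∧ 1 ≤ ‖z‖ ∧ ‖z‖ < r} :=
    fun z => ⟨z.1 + F z, add_nonneg z.2.1 (hF0 z), z.2.2.1.trans
      (norm_le_norm_of_nonneg_of_le z.2.1 (le_add_of_nonneg_right (hF0 z))), hFr z⟩
  let σ : ℕ → {z : Y // 0 ≤ z ∧ 1 ≤ ‖z‖ ∧ ‖z‖ < r} :=
    fun n => next^[n] ⟨w, hw, hw1.ge, hw1.trans_lt hr⟩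
  have hσ : ∀ n, w + ∑ i ∈ Finset.range n, F (σ i) = (σ n).1 := by
    intro n
    induction n with
    | zero => simp [σ]
    | succ n ih =>
      rw [Finset.sum_range_succ, ← add_assoc, ih]
      simp only [σ, Function.iterate_succ_apply']
      rfl
  exact ⟨fun n => F (σ n), fun n => hF0 _, fun n => hF1 _, fun n => by
    rw [hσ]; exact (σ n).2.2.2.le⟩

theorem exists_nonneg_norm_eq_one [Nontrivial Y] : ∃ w : Y, 0 ≤ w ∧ ‖w‖ = 1 := by
  obtain ⟨u, hu⟩ := exists_norm_eq Y zero_le_one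
  exact ⟨|u|, abs_nonneg u, by rw [norm_abs_eq_norm, hu]⟩

/-- Lets a sequence built on a positive unit vector control perturbations of an arbitrary point of
the ball. -/
theorem exists_abs_le_norm_eq_one [IsOrderedModule ℝ Y] [Nontrivial Y] {y : Y} (hy : ‖y‖ ≤ 1) :
    ∃ w : Y, |y| ≤ w ∧ ‖w‖ = 1 := by
  rcases eq_or_ne y 0 with rfl | h
  · simpa using exists_nonneg_norm_eq_one (Y := Y)
  · have h0 : 0 < ‖y‖ := norm_pos_iff.2 h
    refine ⟨‖y‖⁻¹ • |y|, ?_, ?_⟩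
    · simpa using smul_le_smul_of_nonneg_right ((one_le_inv₀ h0).2 hy) (abs_nonneg y)
    · rw [norm_smul, norm_inv, norm_norm, norm_abs_eq_norm, inv_mul_cancel₀ h0.ne']

theorem IsLASQPlus.hasDiameterTwoProperty [IsOrderedModule ℝ Y] [Nontrivial Y]
    (hY : IsLASQPlus Y) : HasDiameterTwoProperty Y := by
  rintro V hV ⟨y, hyV, hy⟩
  rw [mem_closedBall_zero_iff] at hy
  set D := (toWeakSpace ℝ Y ⁻¹' V) ∩ Metric.closedBall (0 : Y) 1 with hD
  have hbdd : Bornology.IsBounded D := Metric.isBounded_closedBall.subset Set.inter_subset_right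
  refine le_antisymm ?_ ?_
  · refine (Metric.diam_mono Set.inter_subset_right Metric.isBounded_closedBall).trans ?_
    simpa using Metric.diam_closedBall (x := (0 : Y)) zero_le_one
  have hcont : Tendsto (fun r : ℝ => toWeakSpace ℝ Y (r⁻¹ • y)) (𝓝[>] 1)
      (𝓝 (toWeakSpace ℝ Y y)) := by
    refine tendsto_toWeakSpace fun φ => ?_
    have : Tendsto (fun r : ℝ => r⁻¹ * φ y) (𝓝 1) (𝓝 ((1 : ℝ)⁻¹ * φ y)) :=
      (tendsto_inv₀ one_ne_zero).mul_const _
    simpa using this.mono_left nhdsWithin_le_nhds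
  -- Dividing by `r` compensates for the norm bound `r`, and `r⁻¹ • y` is still in `V` when `r` is
  -- close to `1`.
  have key : ∀ᶠ r : ℝ in 𝓝[>] 1, 2 * r⁻¹ ≤ Metric.diam D := by
    filter_upwards [hcont.eventually (hV.mem_nhds hyV), self_mem_nhdsWithin] with r hrV hr
    have hr0 : 0 < r := one_pos.trans hr
    obtain ⟨w, hyw, hw1⟩ := exists_abs_le_norm_eq_one hy
    have hw : 0 ≤ w := (abs_nonneg y).trans hyw
    obtain ⟨x, hx0, hx1, hxr⟩ := hY.exists_seq hw hw1 hr
    have hsum0 : ∀ n, 0 ≤ ∑ i ∈ Finset.range n, x i := fun n => Finset.sum_nonneg fun i _ => hx0 i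
    have hnull := tendsto_apply_zero_of_norm_sum_le x hx0 r fun n =>
      (norm_le_norm_of_nonneg_of_le (hsum0 n) (le_add_of_nonneg_left hw)).trans (hxr n)
    have hball : ∀ c : ℝ, |c| = 1 → ∀ n, ‖r⁻¹ • (y + c • x n)‖ ≤ 1 := by
      intro c hc n
      rw [norm_smul, norm_inv, Real.norm_of_nonneg hr0.le, inv_mul_le_one₀ hr0]
      -- The sum of the first `n + 1` terms contains `x n`, so together with `w` it dominates `|y +
      -- c • x n|`.
      refine (norm_le_norm_of_abs_le ?_).trans (hxr (n + 1))
      refine (abs_add_le _ _).trans (add_le_add hyw ?_)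
      have hcx : |c • x n| ≤ x n := by
        rcases eq_or_eq_neg_of_abs_eq hc with rfl | rfl <;> simp [abs_of_nonneg (hx0 n)]
      rw [Finset.sum_range_succ]
      exact hcx.trans (le_add_of_nonneg_left (hsum0 n))
    have hlim : ∀ c : ℝ, ∀ᶠ n in atTop, toWeakSpace ℝ Y (r⁻¹ • (y + c • x n)) ∈ V := by
      intro c
      refine (tendsto_toWeakSpace fun φ => ?_).eventually (hV.mem_nhds hrV)
      have : Tendsto (fun n => r⁻¹ * (φ y + c * φ (x n))) atTop (𝓝 (r⁻¹ * (φ y + c * 0))) :=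
        (((hnull φ).const_mul c).const_add _).const_mul _
      simpa only [map_smul, map_add, smul_eq_mul, mul_zero, add_zero] using this
    obtain ⟨n, h1, h2⟩ := ((hlim 1).and (hlim (-1))).exists
    have := Metric.dist_le_diam_of_mem hbdd
      (show r⁻¹ • (y + (1 : ℝ) • x n) ∈ D from
        ⟨h1, mem_closedBall_zero_iff.2 (hball 1 (by simp) n)⟩)
      (show r⁻¹ • (y + (-1 : ℝ) • x n) ∈ D from
        ⟨h2, mem_closedBall_zero_iff.2 (hball (-1) (by simp) n)⟩)
    refine le_trans (le_of_eq ?_) this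
    rw [dist_eq_norm, show r⁻¹ • (y + (1 : ℝ) • x n) - r⁻¹ • (y + (-1 : ℝ) • x n)
      = (2 * r⁻¹) • x n by module, norm_smul, hx1, Real.norm_of_nonneg (by positivity), mul_one]
  have hlim2 : Tendsto (fun r : ℝ => 2 * r⁻¹) (𝓝[>] 1) (𝓝 2) := by
    have : Tendsto (fun r : ℝ => 2 * r⁻¹) (𝓝 1) (𝓝 (2 * (1 : ℝ)⁻¹)) :=
      (tendsto_inv₀ one_ne_zero).const_mul _
    simpa using this.mono_left nhdsWithin_le_nhds
  exact le_of_tendsto hlim2 key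

end NormedLattice

/-! ### Measurable choice of LASQ+ witnesses. -/

section Selection

variable {S : Type*} [MeasurableSpace S] {X : Type*} [NormedAddCommGroup X] [NormedSpace ℝ X]
  [Lattice X] [IsOrderedAddMonoid X] [HasSolidNorm X]

/-- The elements witnessing LASQ+ can be chosen measurably along a strongly measurable function. -/
theorem IsLASQPlus.exists_stronglyMeasurable [IsOrderedModule ℝ X] [Nontrivial X]
    (hX : IsLASQPlus X) {f : S → X} (hf : StronglyMeasurable f) {ε : ℝ} (hε : 0 < ε) :
    ∃ h : S → X, StronglyMeasurable h ∧ ∀ s, 0 ≤ h s ∧ ‖h s‖ = ‖f s‖ ∧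
      ‖f s + h s‖ ≤ (1 + ε) * ‖f s‖ ∧ ‖f s - h s‖ ≤ (1 + ε) * ‖f s‖ := by
  rcases isEmpty_or_nonempty S with hS | hS
  · exact ⟨f, hf, fun s => isEmptyElim s⟩
  -- Off the unit sphere any positive unit vector serves, which makes the choice function total.
  have hsel : ∀ y : X, ∃ x : X, 0 ≤ x ∧ ‖x‖ = 1 ∧
      (‖y‖ = 1 → ‖y + x‖ ≤ 1 + ε / 2 ∧ ‖y - x‖ ≤ 1 + ε / 2) := by
    intro y
    by_cases hy : ‖y‖ = 1
    · obtain ⟨x, h0, h1, h2⟩ := hX y hy (ε / 2) (half_pos hε)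
      exact ⟨x, h0, h1, fun _ => h2⟩
    · obtain ⟨x, h0, h1⟩ := exists_nonneg_norm_eq_one (Y := X)
      exact ⟨x, h0, h1, fun h => absurd h hy⟩
  choose F hF0 hF1 hF using hsel
  set g : S → X := fun s => ‖f s‖⁻¹ • f s with hg
  have hgm : StronglyMeasurable g := hf.norm.inv₀.smul hf
  obtain ⟨t, htg, htc, hgt⟩ := hgm.isSeparable_range.exists_countable_dense_subset
  have htne : t.Nonempty :=
    closure_nonempty_iff.1 ((Set.range_nonempty g).mono hgt)
  obtain ⟨y, rfl⟩ := htc.exists_eq_range htne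
  -- The `ε / 2` absorbs the approximation error; the `1` prevents a unit vector `g s` from being
  -- matched with `y n = 0`, a value `g` takes at the zeros of `f`.
  have hnear : ∀ s, ∃ n, ‖g s - y n‖ < min (ε / 2) 1 := by
    intro s
    obtain ⟨_, ⟨n, rfl⟩, hn⟩ := Metric.mem_closure_iff.1 (hgt ⟨s, rfl⟩) (min (ε / 2) 1)
      (lt_min (half_pos hε) one_pos)
    exact ⟨n, by rwa [← dist_eq_norm]⟩
  classical
  have hN : Measurable fun s => Nat.find (hnear s) :=
    measurable_find hnear fun n => measurableSet_lt
      (hgm.sub stronglyMeasurable_const).norm.measurable measurable_const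
  -- No regularity of `F` is needed: the selection factors through a measurable map into the
  -- discrete space `ℕ`.
  have hxm : StronglyMeasurable fun s => F (y (Nat.find (hnear s))) :=
    (StronglyMeasurable.of_discrete (f := fun n => F (y n))).comp_measurable hN
  refine ⟨fun s => ‖f s‖ • F (y (Nat.find (hnear s))), hf.norm.smul hxm, fun s => ?_⟩
  have hfind := Nat.find_spec (hnear s)
  set n := Nat.find (hnear s)
  refine ⟨smul_nonneg (norm_nonneg _) (hF0 _), by rw [norm_smul, hF1, norm_norm, mul_one], ?_⟩
  rcases eq_or_ne (f s) 0 with h0 | h0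
  · simp [h0]
  have hfs : ‖f s‖ ≠ 0 := norm_ne_zero_iff.2 h0
  have hfg : f s = ‖f s‖ • g s := by rw [hg, smul_inv_smul₀ hfs]
  have hgs : ‖g s‖ = 1 := by rw [hg, norm_smul, norm_inv, norm_norm, inv_mul_cancel₀ hfs]
  have hyn : ‖y n‖ = 1 := by
    obtain ⟨s', hs'⟩ := htg ⟨n, rfl⟩
    rcases eq_or_ne (f s') 0 with h | h
    · have : y n = 0 := by rw [← hs', hg]; simp [h]
      rw [this, sub_zero, hgs] at hfind
      exact absurd (hfind.trans_le (min_le_right _ _)) (lt_irrefl _)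
    · rw [← hs', hg, norm_smul, norm_inv, norm_norm, inv_mul_cancel₀ (norm_ne_zero_iff.2 h)]
  have hfind' : ‖g s - y n‖ ≤ ε / 2 := hfind.le.trans (min_le_left _ _)
  obtain ⟨hp, hm⟩ := hF _ hyn
  have bound : ∀ x : X, ‖y n + x‖ ≤ 1 + ε / 2 → ‖f s + ‖f s‖ • x‖ ≤ (1 + ε) * ‖f s‖ := by
    intro x hx
    have h : f s + ‖f s‖ • x = ‖f s‖ • ((g s - y n) + (y n + x)) := by
      conv_lhs => rw [hfg, norm_smul, hgs, norm_norm, mul_one]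
      module
    rw [h, norm_smul, norm_norm, mul_comm]
    gcongr
    linarith [norm_add_le (g s - y n) (y n + x)]
  refine ⟨bound _ hp, ?_⟩
  have := bound (-F (y n)) (by rwa [← sub_eq_add_neg])
  rwa [smul_neg, ← sub_eq_add_neg] at this

end Selection

/-! ### Transfer to the Köthe–Bochner space. -/

namespace KotheBochner

variable {S : Type*} [MeasurableSpace S] {μ : Measure S} {E : KotheFunctionSpace μ}
  {X : Type*} [NormedAddCommGroup X] [NormedSpace ℝ X]

theorem norm_congr_ae {f g : KotheBochner E X} (h : ∀ᵐ s ∂μ, ‖f.1 s‖ = ‖g.1 s‖) : ‖f‖ = ‖g‖ :=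
  le_antisymm (norm_le_of_ae _ _ (h.mono fun _ hs => hs.le))
    (norm_le_of_ae _ _ (h.mono fun _ hs => hs.ge))

theorem norm_le_mul_of_ae {f g : KotheBochner E X} {c : ℝ} (hc : 0 ≤ c)
    (h : ∀ᵐ s ∂μ, ‖f.1 s‖ ≤ c * ‖g.1 s‖) : ‖f‖ ≤ c * ‖g‖ := by
  rw [← Real.norm_of_nonneg hc, ← norm_smul]
  refine norm_le_of_ae _ _ ?_
  filter_upwards [h, coe_smul_ae c g] with s h1 h2
  rwa [h2, norm_smul, Real.norm_of_nonneg hc]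

variable (E X) in
theorem nontrivial [SigmaFinite μ] [NeZero μ] [Nontrivial X] : Nontrivial (KotheBochner E X) := by
  obtain ⟨x, hx⟩ := exists_ne (0 : X)
  -- σ-finiteness gives a set of positive finite measure, so `E` contains its indicator and `E(X)`
  -- its multiple by `x`.
  obtain ⟨A, hA, -, hA0, hAtop⟩ := Measure.exists_subset_measure_lt_top (μ := μ)
    MeasurableSet.univ (r := 0) (Measure.measure_univ_pos.2 (NeZero.ne μ))
  have hmeas : AEStronglyMeasurable (A.indicator fun _ => x) μ :=
    aestronglyMeasurable_const.indicator hA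
  have hmem : AEEqFun.mk _ hmeas ∈ E.bochnerSubmodule X := by
    refine E.normFn_mem_of_le (E.carrier.smul_mem ‖x‖ (E.indicator_mem A hA hAtop)) ?_
    filter_upwards [AEEqFun.coeFn_mk _ hmeas,
      AEEqFun.coeFn_smul ‖x‖ (AEEqFun.mk (μ := μ) (A.indicator fun _ => (1 : ℝ))
        (aestronglyMeasurable_const.indicator hA)),
      AEEqFun.coeFn_mk (μ := μ) (A.indicator fun _ => (1 : ℝ))
        (aestronglyMeasurable_const.indicator hA)] with s h1 h2 h3
    rw [h1, h2, Pi.smul_apply, h3]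
    by_cases hs : s ∈ A <;> simp [hs]
  refine ⟨⟨⟨AEEqFun.mk _ hmeas, hmem⟩, 0, fun h0 => ?_⟩⟩
  have hae : ∀ᵐ s ∂μ, s ∉ A := by
    filter_upwards [AEEqFun.coeFn_mk _ hmeas, coe_zero_ae (E := E) (X := X)] with s h1 h2 hs
    rw [← h0] at h2
    rw [h1, Set.indicator_of_mem hs] at h2
    exact hx h2
  exact hA0.ne' (measure_eq_zero_iff_ae_notMem.2 hae)

theorem isLASQPlus [Nontrivial X] [Lattice X] [IsOrderedAddMonoid X] [IsOrderedModule ℝ X]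
    [HasSolidNorm X] (hX : IsLASQPlus X) : IsLASQPlus (KotheBochner E X) := by
  intro f hf1 ε hε
  obtain ⟨h, hm, hh⟩ := hX.exists_stronglyMeasurable f.1.stronglyMeasurable hε
  have hmk := AEEqFun.coeFn_mk (μ := μ) h hm.aestronglyMeasurable
  have hmem : AEEqFun.mk h hm.aestronglyMeasurable ∈ E.bochnerSubmodule X := by
    refine E.normFn_mem_of_le f.2 ?_
    filter_upwards [hmk, coeFn_normFn f.1] with s h1 h2
    rw [h1, h2, abs_norm, (hh s).2.1]
  let k : KotheBochner E X := ⟨AEEqFun.mk h hm.aestronglyMeasurable, hmem⟩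
  have hk : ∀ᵐ s ∂μ, k.1 s = h s := hmk
  refine ⟨k, (le_iff_ae _ _).2 ?_, ?_, ?_, ?_⟩
  · filter_upwards [hk, coe_zero_ae (E := E) (X := X)] with s h1 h2
    rw [h1, h2]
    exact (hh s).1
  · rw [← hf1]
    refine norm_congr_ae ?_
    filter_upwards [hk] with s h1
    rw [h1, (hh s).2.1]
  · refine (norm_le_mul_of_ae (g := f) (c := 1 + ε) (by positivity) ?_).trans_eq
      (by rw [hf1, mul_one])
    filter_upwards [hk, coe_add_ae f k] with s h1 h2
    rw [h2, h1]
    exact (hh s).2.2.1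
  · refine (norm_le_mul_of_ae (g := f) (c := 1 + ε) (by positivity) ?_).trans_eq
      (by rw [hf1, mul_one])
    filter_upwards [hk, coe_sub_ae f k] with s h1 h2
    rw [h2, h1]
    exact (hh s).2.2.2

end KotheBochner

/-- Let `μ` be a complete, σ-finite, non-zero measure, `E` a Köthe function space over `μ` and
`X ≠ 0` a real Banach lattice. If `X` is LASQ+, then the Köthe–Bochner space `E(X)` is LASQ+ and
has the diameter two property. -/
theorem corollary3p2 {S : Type*} [MeasurableSpace S] (μ : MeasureTheory.Measure S)
    [μ.IsComplete] [MeasureTheory.SigmaFinite μ] [NeZero μ]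
    (E : KotheFunctionSpace μ)
    (X : Type*) [NormedAddCommGroup X] [NormedSpace ℝ X] [CompleteSpace X] [Nontrivial X]
    [Lattice X] [IsOrderedAddMonoid X] [IsOrderedModule ℝ X] [HasSolidNorm X]
    (hX : IsLASQPlus X) :
    IsLASQPlus (KotheBochner E X) ∧ HasDiameterTwoProperty (KotheBochner E X) := by
  have := KotheBochner.nontrivial E X
  have hE : IsLASQPlus (KotheBochner E X) := KotheBochner.isLASQPlus hX
  exact ⟨hE, hE.hasDiameterTwoProperty⟩
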